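/- Let $F_2$ be the free group of rank $2$ and let Stallings' group be $S=\ker(F_2\times F_2\times F_2\to\mathbb Z)$, where the homomorphism sends each of the six generators to $1$. **Conventions.** Let $\langle A\mid R\rangle$ be a finite presentation, $R$ being a finite set of words on $A^{\pm1}$; $\ell(w)$ is the length of the (not necessarily reduced) word $w$. A *null-sequence* for a word $w$ is a finite sequence of words that begins with $w$, ends with the empty word, and in which each word is obtained from the previous one by a free reduction ($\alpha xx^{-1}\beta\mapsto\alpha\beta$ with $x\in A^{\pm1}$), by a free expansion (the inverse of a free reduction), or by applying a relator ($\alpha u\beta\mapsto\alpha v\beta$, where a cyclic conjugate of $uv^{-1}$ is in $R^{\pm1}$). The *filling length* $\mathrm{FL}(w)$ is the minimum over all null-sequences for $w$ of the maximal length of a word in the sequence, and the *filling length function* is $\mathrm{FL}(n)=\max\{\mathrm{FL}(w): w \text{ represents } 1,\ \ell(w)\le n\}$. A function $f:\mathbb N\to\mathbb N$ is an *isodiametric function* of the presentation if for all $n$ every word $w$ with $\ell(w)\le n$ that represents $1$ is equal in the free group $F(A)$ to a finite product of conjugates $u_i^{-1}r_iu_i$ with $r_i\in R^{\pm1}$ and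 $u_i$ words of length at most $f(n)$. For $f,g:\mathbb N\to\mathbb N$ write $f\preceq g$ if there is a constant $C>0$ with $f(n)\le Cg(Cn+C)+Cn+C$ for all $n$, and $f\simeq g$ if $f\preceq g$ and $g\preceq f$. **Statement.** The group $S$ is presented by $$\langle a,b,c,d,s \mid [a,c],[a,d],[b,c],[b,d],\ s^a=s^b=s^c=s^d\rangle ,$$ where $[x,y]=x^{-1}y^{-1}xy$, $s^x=x^{-1}sx$, and $s^a=s^b=s^c=s^d$ stands for the six relators $s^x(s^y)^{-1}$ with $x$ before $y$ in the list $a,b,c,d$. For every finite presentation $\langle A\mid R\rangle$ of $S$ (in particular for this one): 1. the presentation has a linear isodiametric function, that is, there is a constant $C$ such that $n\mapsto Cn$ is an isodiametric function of it; 2. its filling length function takes finite values and is equivalent to $n\mapsto n$, that is, $\mathrm{FL}\simeq(n\mapsto n)$. -/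

import Mathlib

/-! ### Words, presentations, filling functions

A word on `A^{±1}` is a list of letters `(x, ε)`; `(x, true)` is `x` and `(x, false)` is `x⁻¹`,
as in Mathlib's `FreeGroup.mk`.  A presentation `⟨A ∣ R⟩` is given by a set `R` of words. -/

/-- Words on the letters `x^{±1}`, `x ∈ A` (not necessarily reduced). -/
abbrev GWord (A : Type*) : Type _ := List (A × Bool)

/-- The group `⟨A ∣ R⟩`. -/
abbrev WordPresentedGroup {A : Type*} (R : Set (GWord A)) : Type _ :=
  PresentedGroup ((FreeGroup.mk : GWord A → FreeGroup A) '' R)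

/-- `w` represents the identity of `⟨A ∣ R⟩`. -/
def NullHomotopic {A : Type*} (R : Set (GWord A)) (w : GWord A) : Prop :=
  PresentedGroup.mk ((FreeGroup.mk : GWord A → FreeGroup A) '' R) (FreeGroup.mk w) = 1

/-- The words in `R^{±1}`. -/
def symmRelators {A : Type*} (R : Set (GWord A)) : Set (GWord A) :=
  {r | r ∈ R ∨ FreeGroup.invRev r ∈ R}

/-- Free reduction `α x x⁻¹ β ↦ α β`, where `x ∈ A^{±1}`. -/
def FreeReductionMove {A : Type*} (w w' : GWord A) : Prop :=
  ∃ (α β : GWord A) (x : A) (ε : Bool), w = α ++ [(x, ε), (x, !ε)] ++ β ∧ w' = α ++ β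

/-- Application of a relator: `α u β ↦ α v β`, where a cyclic conjugate of `u v⁻¹` is
in `R^{±1}`. -/
def RelatorMove {A : Type*} (R : Set (GWord A)) (w w' : GWord A) : Prop :=
  ∃ α β u v : GWord A, w = α ++ u ++ β ∧ w' = α ++ v ++ β ∧
    ∃ r ∈ symmRelators R, (u ++ FreeGroup.invRev v).IsRotated r

/-- One move: a free reduction, a free expansion, or an application of a relator. -/
def WordMove {A : Type*} (R : Set (GWord A)) (w w' : GWord A) : Prop :=
  FreeReductionMove w w' ∨ FreeReductionMove w' w ∨ RelatorMove R w w'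

/-- `σ` is a null-sequence for `w`: a finite sequence of words that starts with `w`, ends with the
empty word, and in which each word is obtained from the previous one by one move. -/
def IsNullSequence {A : Type*} (R : Set (GWord A)) (w : GWord A) (σ : List (GWord A)) : Prop :=
  σ.head? = some w ∧ σ.getLast? = some [] ∧ σ.IsChain (WordMove R)

/-- The filling length `FL(w)`: the minimum, over all null-sequences for `w`, of the maximal length
of a word in the sequence (`⊤` if there is no null-sequence). -/
noncomputable def fillingLength {A : Type*} (R : Set (GWord A)) (w : GWord A) : ℕ∞ :=
  ⨅ (σ : List (GWord A)) (_ : IsNullSequence R w σ), ⨆ v ∈ σ, (v.length : ℕ∞)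

/-- The filling length function of `⟨A ∣ R⟩`:
`FL(n) = sup {FL(w) ∣ w represents 1 and ℓ(w) ≤ n}`. -/
noncomputable def fillingLengthFunction {A : Type*} (R : Set (GWord A)) (n : ℕ) : ℕ∞ :=
  ⨆ (w : GWord A) (_ : NullHomotopic R w) (_ : w.length ≤ n), fillingLength R w

/-- `w` is equal in the free group `F(A)` to a (finite, possibly empty) product of conjugates
`u⁻¹ r u` with `r ∈ R^{±1}` and conjugating words `u` of length at most `d`. -/
def HasFillingOfDiameter {A : Type*} (R : Set (GWord A)) (w : GWord A) (d : ℕ) : Prop :=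
  ∃ L : List (GWord A × GWord A),
    (∀ p ∈ L, p.1.length ≤ d ∧ p.2 ∈ symmRelators R) ∧
    FreeGroup.mk w =
      (L.map fun p => (FreeGroup.mk p.1)⁻¹ * FreeGroup.mk p.2 * FreeGroup.mk p.1).prod

/-- `f` is an isodiametric function for `⟨A ∣ R⟩`: every word `w` of length at most `n` that
represents the identity has a filling of diameter at most `f n`. -/
def IsIsodiametricFunction {A : Type*} (R : Set (GWord A)) (f : ℕ → ℕ) : Prop :=
  ∀ (n : ℕ) (w : GWord A), NullHomotopic R w → w.length ≤ n → HasFillingOfDiameter R w (f n)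

/-- `f ⪯ g`. -/
def FillingLE (f g : ℕ → ℕ) : Prop :=
  ∃ C : ℕ, 0 < C ∧ ∀ n : ℕ, f n ≤ C * g (C * n + C) + C * n + C

/-- `f ≃ g`. -/
def FillingEquiv (f g : ℕ → ℕ) : Prop :=
  FillingLE f g ∧ FillingLE g f

/-! ### Stallings' group -/

/-- The exponent sum `F₂ → ℤ`, sending both generators to `1` (that is, to `t`). -/
def exponentSum : FreeGroup (Fin 2) →* Multiplicative ℤ :=
  FreeGroup.lift fun _ => Multiplicative.ofAdd (1 : ℤ)

/-- The homomorphism `F₂ × F₂ × F₂ → ℤ` that sends all six generators to `1`. -/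
def stallingsHom :
    FreeGroup (Fin 2) × FreeGroup (Fin 2) × FreeGroup (Fin 2) →* Multiplicative ℤ :=
  exponentSum.coprod (exponentSum.coprod exponentSum)

/-- Stallings' group, the kernel of `F₂ × F₂ × F₂ → ℤ`. -/
abbrev StallingsGroup : Type := stallingsHom.ker

/-- The letters of the standard presentation. -/
inductive StallingsGen : Type
  | a
  | b
  | c
  | d
  | s

/-- The word `[x, y] = x⁻¹ y⁻¹ x y`. -/
def commWord {A : Type*} (x y : A) : GWord A :=
  [(x, false), (y, false), (x, true), (y, true)]

/-- The word `s^x s^{-y} = x⁻¹ s x y⁻¹ s⁻¹ y`. -/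
def conjWord {A : Type*} (s x y : A) : GWord A :=
  [(x, false), (s, true), (x, true), (y, false), (s, false), (y, true)]

open StallingsGen in
/-- The relators of `⟨a, b, c, d, s ∣ [a,c], [a,d], [b,c], [b,d], s^a = s^b = s^c = s^d⟩`. -/
def stallingsRelators : Set (GWord StallingsGen) :=
  {commWord a c, commWord a d, commWord b c, commWord b d,
    conjWord s a b, conjWord s a c, conjWord s a d,
    conjWord s b c, conjWord s b d, conjWord s c d}

/-!
Both claims follow from one property of a finite presentation: every word that represents `1` can
be reduced to the empty word through words of length linearly bounded in its own
(`HasLinearDerivations`). Such a reduction bounds the filling length by definition. It also bounds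
the diameter, because applying a relator to `α p β` multiplies the word by a conjugate of the
relator, by a prefix of `α p q⁻¹` for the replacement `q` of `p`. The other half of
`FL ≃ (n ↦ n)` is free, since `⪯` allows a linear error term.

The property does not depend on the finite presentation (`HasLinearDerivations.of_mulEquiv`). There
are finitely many words of bounded length, so all relations among them have derivations in bounded
length (`exists_uniform_derivesWithin`). Hence a word can be rewritten letter by letter in the
generators of another presentation, and a derivation can be carried over move by move.

For the standard presentation of Stallings' group the key point is that `s` commutes with every word
`h` in `a, b, c, d` of exponent sum `0`, through words of length `O(|h|)`
(`exists_derivesWithin_s`). A letter that commutes with `z` and conjugates `s` as `z` does lets `s`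
pass at the cost of conjugating it by `z`. Choosing `z = a` for the letters `c, d` and `z = c` for
the letters `a, b`, one turns `h s` into `qsq⁻¹h` with a word `q` in `c` of exponent sum `0`, and
this is freely equal to `s h`. Collecting the letters of a word one after the other, one reaches a
normal form `u v t`, `u` in `a, s`, `v` in `a, b` and `t` in `c, d`, where `v t` has exponent sum
`0` (`exists_derivesWithin_normalForm`). In `F₂ × F₂ × F₂`, where
`a = (x, 1, x⁻¹)`, `b = (y, 1, x⁻¹)`, `c = (1, x, x⁻¹)`, `d = (1, y, x⁻¹)`, `s = (1, 1, y x⁻¹)`,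
the third coordinate of `u v t` is that of `u`, and it determines `u` in the free group. So the
normal form of a word that is trivial there consists of freely trivial words. This gives at once the
linear derivations and the injectivity of the map from the presented group to `F₂ × F₂ × F₂`.
-/

/-! ### Derivations through words of bounded length -/

/-- `u` can be transformed into `v` by finitely many moves between words of length at most `N`.
(The empty derivation is allowed, whatever the length of `u`.) -/
def DerivesWithin {A : Type*} (R : Set (GWord A)) (N : ℕ) : GWord A → GWord A → Prop :=
  Relation.ReflTransGen fun u v => WordMove R u v ∧ u.length ≤ N ∧ v.length ≤ N

/-- The element of `⟨A ∣ R⟩` represented by a word. -/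
def wordValue {A : Type*} (R : Set (GWord A)) (w : GWord A) : WordPresentedGroup R :=
  PresentedGroup.mk ((FreeGroup.mk : GWord A → FreeGroup A) '' R) (FreeGroup.mk w)

section Derivations

variable {A : Type*} {R : Set (GWord A)}

theorem wordValue_append (u v : GWord A) :
    wordValue R (u ++ v) = wordValue R u * wordValue R v := by
  simp only [wordValue, ← FreeGroup.mul_mk, map_mul]

theorem wordValue_invRev (u : GWord A) :
    wordValue R (FreeGroup.invRev u) = (wordValue R u)⁻¹ := by
  simp only [wordValue, ← FreeGroup.inv_mk, map_inv]

theorem wordValue_eq_one_of_mem {r : GWord A} (hr : r ∈ R) : wordValue R r = 1 :=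
  PresentedGroup.mk_eq_one_iff.2 (Subgroup.subset_normalClosure ⟨r, hr, rfl⟩)

theorem invRev_mem_symmRelators {r : GWord A} (hr : r ∈ symmRelators R) :
    FreeGroup.invRev r ∈ symmRelators R := by
  rcases hr with hr | hr
  · exact Or.inr (by rwa [FreeGroup.invRev_invRev])
  · exact Or.inl hr

theorem invRev_isRotated {u v : GWord A} (h : u.IsRotated v) :
    (FreeGroup.invRev u).IsRotated (FreeGroup.invRev v) := by
  simpa only [FreeGroup.invRev] using (h.map _).reverse

/-- If a word `u` is a cyclic conjugate of `r`, it is freely equal to `p r p⁻¹` for a prefix `p`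
of `u`. -/
theorem exists_mk_eq_conj_of_isRotated {u r : GWord A} (h : u.IsRotated r) :
    ∃ p : GWord A, p.length ≤ u.length ∧
      FreeGroup.mk u = FreeGroup.mk p * FreeGroup.mk r * (FreeGroup.mk p)⁻¹ := by
  obtain ⟨n, hn, rfl⟩ := List.isRotated_iff_mod.1 h
  refine ⟨u.take n, List.length_take_le' n u, ?_⟩
  rw [List.rotate_eq_drop_append_take hn, ← FreeGroup.mul_mk, mul_assoc, mul_assoc,
    mul_inv_cancel, mul_one, FreeGroup.mul_mk, List.take_append_drop]

theorem FreeReductionMove.mk_eq {u v : GWord A} (h : FreeReductionMove u v) :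
    FreeGroup.mk u = FreeGroup.mk v := by
  obtain ⟨α, β, x, ε, rfl, rfl⟩ := h
  refine Quot.sound ?_
  simp

theorem WordMove.symm {u v : GWord A} (h : WordMove R u v) : WordMove R v u := by
  rcases h with h | h | ⟨α, β, p, q, rfl, rfl, r, hr, hrot⟩
  · exact Or.inr (Or.inl h)
  · exact Or.inl h
  · refine Or.inr (Or.inr ⟨α, β, q, p, rfl, rfl, _, invRev_mem_symmRelators hr, ?_⟩)
    simpa only [FreeGroup.invRev_append, FreeGroup.invRev_invRev] using invRev_isRotated hrot

theorem WordMove.context {u v : GWord A} (h : WordMove R u v) (α β : GWord A) :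
    WordMove R (α ++ u ++ β) (α ++ v ++ β) := by
  rcases h with ⟨α', β', x, ε, rfl, rfl⟩ | ⟨α', β', x, ε, rfl, rfl⟩ |
    ⟨α', β', p, q, rfl, rfl, h⟩
  · exact Or.inl ⟨α ++ α', β' ++ β, x, ε, by simp, by simp⟩
  · exact Or.inr (Or.inl ⟨α ++ α', β' ++ β, x, ε, by simp, by simp⟩)
  · exact Or.inr (Or.inr ⟨α ++ α', β' ++ β, p, q, by simp, by simp, h⟩)

namespace DerivesWithin

theorem refl (N : ℕ) (u : GWord A) : DerivesWithin R N u u := Relation.ReflTransGen.refl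

theorem trans {N : ℕ} {u v w : GWord A} (h : DerivesWithin R N u v)
    (h' : DerivesWithin R N v w) : DerivesWithin R N u w := Relation.ReflTransGen.trans h h'

theorem symm {N : ℕ} {u v : GWord A} (h : DerivesWithin R N u v) : DerivesWithin R N v u := by
  induction h with
  | refl => exact refl _ _
  | tail _ h ih => exact Relation.ReflTransGen.head ⟨h.1.symm, h.2.2, h.2.1⟩ ih

theorem mono {N N' : ℕ} {u v : GWord A} (h : DerivesWithin R N u v) (hN : N ≤ N') :
    DerivesWithin R N' u v :=
  Relation.ReflTransGen.mono (fun _ _ h => ⟨h.1, h.2.1.trans hN, h.2.2.trans hN⟩) _ _ h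

theorem context {N N' : ℕ} {u v : GWord A} (h : DerivesWithin R N u v) (α β : GWord A)
    (hN : α.length + N + β.length ≤ N') : DerivesWithin R N' (α ++ u ++ β) (α ++ v ++ β) := by
  induction h with
  | refl => exact refl _ _
  | tail _ h ih =>
    refine ih.tail ⟨h.1.context α β, ?_, ?_⟩ <;> simp only [List.length_append] <;> omega

theorem append_left {N N' : ℕ} {u v : GWord A} (h : DerivesWithin R N u v) (α : GWord A)
    (hN : α.length + N ≤ N') : DerivesWithin R N' (α ++ u) (α ++ v) := by
  simpa using h.context α [] (by simpa using hN)

theorem append_right {N N' : ℕ} {u v : GWord A} (h : DerivesWithin R N u v) (β : GWord A)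
    (hN : N + β.length ≤ N') : DerivesWithin R N' (u ++ β) (v ++ β) := by
  simpa using h.context [] β (by simpa using hN)

theorem of_red {N : ℕ} {u v : GWord A} (h : FreeGroup.Red u v) (hu : u.length ≤ N) :
    DerivesWithin R N u v := by
  induction h with
  | refl => exact refl _ _
  | @tail v w huv hvw ih =>
    have hv := FreeGroup.Red.length_le huv
    have hw := hvw.length
    refine ih.tail ⟨?_, by omega, by omega⟩
    obtain @⟨α, β, x, ε⟩ := hvw
    exact Or.inl ⟨α, β, x, ε, by simp, rfl⟩

/-- Freely equal words are related by free moves that do not pass through longer words. -/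
theorem of_mk_eq {N : ℕ} {u v : GWord A} (h : FreeGroup.mk u = FreeGroup.mk v)
    (hu : u.length ≤ N) (hv : v.length ≤ N) : DerivesWithin R N u v := by
  obtain ⟨w, huw, hvw⟩ := FreeGroup.Red.exact.1 h
  exact (of_red huw hu).trans (of_red hvw hv).symm

theorem mul_invRev_cancel {N : ℕ} (u : GWord A) (h : 2 * u.length ≤ N) :
    DerivesWithin R N (u ++ FreeGroup.invRev u) [] := by
  refine of_mk_eq ?_ ?_ (Nat.zero_le _)
  · rw [← FreeGroup.mul_mk, ← FreeGroup.inv_mk, mul_inv_cancel]; rfl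
  · rw [List.length_append, FreeGroup.invRev_length]; omega

theorem relator {r : GWord A} (hr : r ∈ R) : DerivesWithin R r.length r [] :=
  .single ⟨Or.inr (Or.inr ⟨[], [], r, [], by simp, by simp, r, Or.inl hr,
    by simpa [FreeGroup.invRev] using List.IsRotated.refl r⟩), le_rfl, Nat.zero_le _⟩

end DerivesWithin

theorem WordMove.wordValue_eq {u v : GWord A} (h : WordMove R u v) :
    wordValue R u = wordValue R v := by
  rcases h with h | h | ⟨α, β, p, q, rfl, rfl, r, hr, hrot⟩
  · exact congrArg (PresentedGroup.mk _) h.mk_eq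
  · exact congrArg (PresentedGroup.mk _) h.mk_eq.symm
  · have hr1 : wordValue R r = 1 := by
      rcases hr with hr | hr
      · exact wordValue_eq_one_of_mem hr
      · simpa [wordValue_invRev] using wordValue_eq_one_of_mem hr
    obtain ⟨t, -, ht⟩ := exists_mk_eq_conj_of_isRotated hrot
    have : wordValue R (p ++ FreeGroup.invRev q) = 1 := by
      rw [wordValue, ht, map_mul, map_mul, map_inv]
      change _ * wordValue R r * _ = 1
      rw [hr1, mul_one, mul_inv_cancel]
    rw [wordValue_append, wordValue_invRev, mul_inv_eq_one] at this
    rw [wordValue_append, wordValue_append, this, wordValue_append, wordValue_append]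

theorem DerivesWithin.wordValue_eq {N : ℕ} {u v : GWord A} (h : DerivesWithin R N u v) :
    wordValue R u = wordValue R v := by
  induction h with
  | refl => rfl
  | tail _ h ih => exact ih.trans h.1.wordValue_eq

/-- The elements of the free group that have a representing word from which the empty word can be
derived. -/
def derivablyTrivialSubgroup (R : Set (GWord A)) : Subgroup (FreeGroup A) where
  carrier := {g | ∃ w, FreeGroup.mk w = g ∧ ∃ N, DerivesWithin R N w []}
  one_mem' := ⟨[], rfl, 0, .refl _ _⟩
  mul_mem' := by
    rintro _ _ ⟨u, rfl, M, hu⟩ ⟨v, rfl, N, hv⟩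
    exact ⟨u ++ v, FreeGroup.mul_mk.symm, M + v.length + N,
      (hu.append_right v (by omega)).trans (hv.mono (by omega))⟩
  inv_mem' := by
    rintro _ ⟨u, rfl, M, hu⟩
    refine ⟨FreeGroup.invRev u, FreeGroup.inv_mk.symm, u.length + M + 2 * u.length, ?_⟩
    have h := hu.symm.append_left (N' := u.length + M + 2 * u.length) (FreeGroup.invRev u)
      (by rw [FreeGroup.invRev_length]; omega)
    rw [List.append_nil] at h
    refine h.trans ?_
    simpa using DerivesWithin.mul_invRev_cancel (R := R) (FreeGroup.invRev u)
      (by rw [FreeGroup.invRev_length]; omega)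

instance derivablyTrivialSubgroup_normal (R : Set (GWord A)) :
    (derivablyTrivialSubgroup R).Normal where
  conj_mem := by
    rintro _ ⟨u, rfl, M, hu⟩ ⟨t⟩
    refine ⟨t ++ u ++ FreeGroup.invRev t, ?_, t.length + M + t.length + 2 * t.length, ?_⟩
    · rw [← FreeGroup.mul_mk, ← FreeGroup.mul_mk, ← FreeGroup.inv_mk]; rfl
    · refine (hu.context t _ (by rw [FreeGroup.invRev_length]; omega)).trans ?_
      rw [List.append_nil]
      exact .mul_invRev_cancel _ (by omega)

theorem exists_derivesWithin_nil {w : GWord A} (h : wordValue R w = 1) :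
    ∃ N, DerivesWithin R N w [] := by
  have h1 : FreeGroup.mk w ∈ derivablyTrivialSubgroup R := by
    refine Subgroup.normalClosure_le_normal ?_ (PresentedGroup.mk_eq_one_iff.1 h)
    rintro _ ⟨r, hr, rfl⟩
    exact ⟨r, rfl, _, .relator hr⟩
  obtain ⟨w', hw', N, hN⟩ := h1
  exact ⟨w.length + w'.length + N, DerivesWithin.trans
    (.of_mk_eq hw'.symm (by omega) (by omega)) (hN.mono (by omega))⟩

/-- Words that represent the same element are related by a derivation. -/
theorem exists_derivesWithin {u v : GWord A} (h : wordValue R u = wordValue R v) :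
    ∃ N, DerivesWithin R N u v := by
  obtain ⟨N, hN⟩ := exists_derivesWithin_nil (R := R) (w := u ++ FreeGroup.invRev v)
    (by rw [wordValue_append, wordValue_invRev, h, mul_inv_cancel])
  refine ⟨u.length + N + 2 * v.length, DerivesWithin.trans (v := u ++ FreeGroup.invRev v ++ v)
    (.of_mk_eq ?_ (by omega) ?_) (hN.append_right v (by omega))⟩
  · rw [← FreeGroup.mul_mk, ← FreeGroup.mul_mk, ← FreeGroup.inv_mk, inv_mul_cancel_right]
  · simp only [List.length_append, FreeGroup.invRev_length]; omega

/-- Over a finite alphabet there are finitely many words of bounded length, so that all relations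
between them are derived within a common bound. -/
theorem exists_uniform_derivesWithin [Finite A] (R : Set (GWord A)) (L : ℕ) :
    ∃ K, ∀ u v : GWord A, u.length ≤ L → v.length ≤ L → wordValue R u = wordValue R v →
      DerivesWithin R K u v := by
  have hfin := (List.finite_length_le (A × Bool) L).prod (List.finite_length_le (A × Bool) L)
  have hex : ∀ p : GWord A × GWord A, ∃ N, wordValue R p.1 = wordValue R p.2 →
      DerivesWithin R N p.1 p.2 := fun p => by
    by_cases h : wordValue R p.1 = wordValue R p.2
    · exact (exists_derivesWithin h).imp fun _ h _ => h
    · exact ⟨0, fun h' => absurd h' h⟩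
  choose N hN using hex
  obtain ⟨K, hK⟩ := (hfin.image N).bddAbove
  exact ⟨K, fun u v hu hv h => (hN (u, v) h).mono (hK ⟨(u, v), ⟨hu, hv⟩, rfl⟩)⟩

end Derivations

/-! ### Filling length and diameter of a derivation -/

section Filling

variable {A : Type*} {R : Set (GWord A)}

theorem DerivesWithin.exists_isNullSequence {N : ℕ} {w : GWord A} (h : DerivesWithin R N w [])
    (hw : w.length ≤ N) :
    ∃ σ, IsNullSequence R w σ ∧ ∀ v ∈ σ, v.length ≤ N := by
  induction h using Relation.ReflTransGen.head_induction_on with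
  | refl => exact ⟨[[]], ⟨rfl, rfl, by simp⟩, by simp⟩
  | @head u v huv _ ih =>
    obtain ⟨σ, ⟨h1, h2, h3⟩, h4⟩ := ih huv.2.2
    obtain ⟨τ, rfl⟩ : ∃ τ, σ = v :: τ := by
      cases σ with
      | nil => simp at h1
      | cons x τ => exact ⟨τ, by simpa using h1⟩
    refine ⟨u :: v :: τ, ⟨rfl, ?_, List.isChain_cons_cons.2 ⟨huv.1, h3⟩⟩, ?_⟩
    · rwa [List.getLast?_cons_cons]
    · intro x hx
      rcases List.mem_cons.1 hx with rfl | hx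
      · exact hw
      · exact h4 x hx

theorem DerivesWithin.fillingLength_le {N : ℕ} {w : GWord A} (h : DerivesWithin R N w [])
    (hw : w.length ≤ N) : fillingLength R w ≤ N := by
  obtain ⟨σ, hσ, hN⟩ := h.exists_isNullSequence hw
  exact (iInf₂_le σ hσ).trans (iSup₂_le fun v hv => by exact_mod_cast hN v hv)

theorem HasFillingOfDiameter.mono {w : GWord A} {d d' : ℕ} (h : HasFillingOfDiameter R w d)
    (hd : d ≤ d') : HasFillingOfDiameter R w d' := by
  obtain ⟨L, h1, h2⟩ := h
  exact ⟨L, fun p hp => ⟨(h1 p hp).1.trans hd, (h1 p hp).2⟩, h2⟩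

/-- Replacing `p` by `q` in `α p β` multiplies the word by a conjugate of a relator, the
conjugating word being the inverse of `α t` for a prefix `t` of `p q⁻¹`: this accounts for the
factor `2`. -/
theorem DerivesWithin.hasFillingOfDiameter {N : ℕ} {w : GWord A} (h : DerivesWithin R N w []) :
    HasFillingOfDiameter R w (2 * N) := by
  induction h using Relation.ReflTransGen.head_induction_on with
  | refl => exact ⟨[], by simp, rfl⟩
  | @head u v huv _ ih =>
    obtain ⟨L, h1, h2⟩ := ih
    obtain ⟨h | h | ⟨α, β, p, q, rfl, rfl, r, hr, hrot⟩, hu, hv⟩ := huv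
    · exact ⟨L, h1, h.mk_eq.trans h2⟩
    · exact ⟨L, h1, h.mk_eq.symm.trans h2⟩
    · obtain ⟨t, ht, hconj⟩ := exists_mk_eq_conj_of_isRotated hrot
      refine ⟨(FreeGroup.invRev (α ++ t), r) :: L, ?_, ?_⟩
      · intro x hx
        rcases List.mem_cons.1 hx with rfl | hx
        · refine ⟨?_, hr⟩
          simp only [FreeGroup.invRev_length, List.length_append] at *
          omega
        · exact h1 x hx
      · rw [List.map_cons, List.prod_cons, ← h2]
        simp only [← FreeGroup.mul_mk, ← FreeGroup.inv_mk, inv_inv, mul_inv_rev] at hconj ⊢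
        have : FreeGroup.mk p = FreeGroup.mk t * FreeGroup.mk r * (FreeGroup.mk t)⁻¹ *
            FreeGroup.mk q := by rw [← hconj, inv_mul_cancel_right]
        rw [this]
        group

/-- Every null-homotopic word can be reduced to the empty word through words of length linearly
bounded in its own length. -/
def HasLinearDerivations (R : Set (GWord A)) : Prop :=
  ∃ C, ∀ w : GWord A, wordValue R w = 1 → DerivesWithin R (C * w.length + C) w []

theorem HasLinearDerivations.isIsodiametricFunction (h : HasLinearDerivations R) :
    ∃ C : ℕ, IsIsodiametricFunction R (fun n => C * n) := by
  obtain ⟨C, hC⟩ := h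
  refine ⟨4 * C, fun n w hw hn => ?_⟩
  rcases Nat.eq_zero_or_pos n with rfl | hpos
  · obtain rfl : w = [] := List.eq_nil_of_length_eq_zero (by omega)
    exact ⟨[], by simp, rfl⟩
  · refine (hC w hw).hasFillingOfDiameter.mono ?_
    nlinarith [Nat.mul_le_mul_left C hn, Nat.mul_le_mul_left C hpos]

theorem HasLinearDerivations.fillingLengthFunction_equiv (h : HasLinearDerivations R) :
    ∃ FL : ℕ → ℕ, (∀ n, (FL n : ℕ∞) = fillingLengthFunction R n) ∧
      FillingEquiv FL (fun n => n) := by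
  obtain ⟨C, hC⟩ := h
  have hle : ∀ n, fillingLengthFunction R n ≤ (((C + 1) * n + C : ℕ) : ℕ∞) := fun n =>
    iSup_le fun w => iSup₂_le fun hw hn =>
      ((hC w hw).mono (by nlinarith [Nat.mul_le_mul_left C hn])).fillingLength_le
        (by nlinarith [Nat.mul_le_mul_left C hn])
  have hcast : ∀ n, ((fillingLengthFunction R n).toNat : ℕ∞) = fillingLengthFunction R n :=
    fun n => ENat.natCast_toNat (ne_top_of_le_ne_top (ENat.natCast_ne_top _) (hle n))
  refine ⟨fun n => (fillingLengthFunction R n).toNat, hcast, ⟨C + 1, by omega, fun n => ?_⟩,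
    ⟨1, one_pos, fun n => ?_⟩⟩
  · have h1 := hle n
    rw [← hcast n] at h1
    have h2 : (fillingLengthFunction R n).toNat ≤ (C + 1) * n + C := by exact_mod_cast h1
    dsimp only
    omega
  · dsimp only
    omega

end Filling

/-! ### Change of presentation -/

section Substitution

variable {A B : Type*}

/-- Substitution of a word `ρ x` for every letter `x` (and of its formal inverse for `x⁻¹`). -/
def substWord (ρ : B → GWord A) (w : GWord B) : GWord A :=
  w.flatMap fun x => if x.2 then ρ x.1 else FreeGroup.invRev (ρ x.1)

theorem substWord_append (ρ : B → GWord A) (u v : GWord B) :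
    substWord ρ (u ++ v) = substWord ρ u ++ substWord ρ v := List.flatMap_append

theorem mk_substWord (ρ : B → GWord A) (w : GWord B) :
    FreeGroup.mk (substWord ρ w) =
      FreeGroup.lift (fun x => FreeGroup.mk (ρ x)) (FreeGroup.mk w) := by
  induction w with
  | nil => rfl
  | cons x w ih =>
    obtain ⟨x, ε⟩ := x
    change FreeGroup.mk ((if ε then ρ x else FreeGroup.invRev (ρ x)) ++ substWord ρ w) = _
    rw [← FreeGroup.mul_mk, ih, FreeGroup.lift_mk, FreeGroup.lift_mk, List.map_cons,
      List.prod_cons]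
    cases ε <;> simp [FreeGroup.inv_mk]

theorem length_substWord_le (ρ : B → GWord A) {L : ℕ} (hL : ∀ x, (ρ x).length ≤ L)
    (w : GWord B) : (substWord ρ w).length ≤ L * w.length := by
  induction w with
  | nil => simp [substWord]
  | cons x w ih =>
    obtain ⟨x, ε⟩ := x
    change ((if ε then ρ x else FreeGroup.invRev (ρ x)) ++ substWord ρ w).length ≤ _
    have := hL x
    rw [List.length_append, List.length_cons, Nat.mul_succ]
    cases ε <;> simp only [Bool.false_eq_true, if_true, if_false, FreeGroup.invRev_length] <;> omega

theorem wordValue_substWord {R : Set (GWord A)} {S : Set (GWord B)} (ρ : B → GWord A)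
    (f : WordPresentedGroup S →* WordPresentedGroup R)
    (hf : ∀ x, f (PresentedGroup.of x) = wordValue R (ρ x)) (w : GWord B) :
    wordValue R (substWord ρ w) = f (wordValue S w) := by
  have : (PresentedGroup.mk ((FreeGroup.mk : GWord A → FreeGroup A) '' R)).comp
        (FreeGroup.lift fun x => FreeGroup.mk (ρ x)) =
      f.comp (PresentedGroup.mk ((FreeGroup.mk : GWord B → FreeGroup B) '' S)) := by
    ext x
    simpa [wordValue, PresentedGroup.of] using (hf x).symm
  rw [wordValue, mk_substWord]
  exact DFunLike.congr_fun this (FreeGroup.mk w)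

theorem exists_length_le [Finite B] (ρ : B → GWord A) : ∃ L, ∀ x, (ρ x).length ≤ L := by
  obtain ⟨L, hL⟩ := (Set.finite_range fun x => (ρ x).length).bddAbove
  exact ⟨L, fun x => hL ⟨x, rfl⟩⟩

/-- A homomorphism between finitely presented groups carries derivations to derivations, and
stretches the lengths linearly. -/
theorem exists_derivesWithin_substWord [Finite A] [Finite B] {R : Set (GWord A)}
    {S : Set (GWord B)} (hS : S.Finite) (ρ : B → GWord A)
    (f : WordPresentedGroup S →* WordPresentedGroup R)
    (hf : ∀ x, f (PresentedGroup.of x) = wordValue R (ρ x)) :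
    ∃ C, ∀ N u v, DerivesWithin S N u v →
      DerivesWithin R (C * N + C) (substWord ρ u) (substWord ρ v) := by
  obtain ⟨L, hL⟩ := exists_length_le ρ
  obtain ⟨M, hM⟩ := (hS.image List.length).bddAbove
  obtain ⟨K, hK⟩ := exists_uniform_derivesWithin R (L * M)
  refine ⟨2 * L + K, fun N u v h => ?_⟩
  induction h with
  | refl => exact .refl _ _
  | @tail v w _ h ih =>
    refine ih.trans ?_
    obtain ⟨h, hv, hw⟩ := h
    have hv' := (length_substWord_le ρ hL v).trans (Nat.mul_le_mul_left L hv)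
    have hw' := (length_substWord_le ρ hL w).trans (Nat.mul_le_mul_left L hw)
    have hN : 2 * (L * N) + K ≤ (2 * L + K) * N + (2 * L + K) := by nlinarith
    have key : ∀ {u v : GWord B}, FreeReductionMove u v →
        FreeGroup.mk (substWord ρ u) = FreeGroup.mk (substWord ρ v) := by
      intro u v h
      rw [mk_substWord, mk_substWord, h.mk_eq]
    have hval : wordValue S v = wordValue S w := h.wordValue_eq
    rcases h with h | h | ⟨α, β, p, q, rfl, rfl, r, hr, hrot⟩
    · exact .of_mk_eq (key h) (by omega) (by omega)
    · exact .of_mk_eq (key h).symm (by omega) (by omega)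
    · have hlen : p.length + q.length ≤ M := by
        have h1 : r.length ≤ M := by
          rcases hr with hr | hr
          · exact hM ⟨r, hr, rfl⟩
          · simpa only [FreeGroup.invRev_length] using hM ⟨_, hr, rfl⟩
        have h2 := hrot.perm.length_eq
        rw [List.length_append, FreeGroup.invRev_length] at h2
        omega
      have hpq : wordValue S p = wordValue S q := by
        simpa only [wordValue_append, mul_left_inj, mul_right_inj] using hval
      have hp := (length_substWord_le ρ hL p).trans (Nat.mul_le_mul_left L (by omega : _ ≤ M))
      have hq := (length_substWord_le ρ hL q).trans (Nat.mul_le_mul_left L (by omega : _ ≤ M))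
      simp only [substWord_append, List.length_append] at hv' ⊢
      refine (hK _ _ hp hq ?_).context _ _ (by omega)
      rw [wordValue_substWord ρ f hf, wordValue_substWord ρ f hf, hpq]

theorem exists_wordValue_eq {R : Set (GWord A)} (g : WordPresentedGroup R) :
    ∃ w, wordValue R w = g := by
  obtain ⟨⟨w⟩, hw⟩ := PresentedGroup.mk_surjective _ g
  exact ⟨w, hw⟩

/-- Linear derivations do not depend on the finite presentation of the group: a word over `A` is
rewritten, letter by letter, into the image of a word over `B`, which is then reduced along the
image of its own derivation. -/
theorem HasLinearDerivations.of_mulEquiv [Finite A] [Finite B] {R : Set (GWord A)}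
    {S : Set (GWord B)} (hS : S.Finite) (e : WordPresentedGroup R ≃* WordPresentedGroup S)
    (h : HasLinearDerivations S) : HasLinearDerivations R := by
  choose τ hτ using fun x : A => exists_wordValue_eq (e (PresentedGroup.of x))
  choose ρ hρ using fun x : B => exists_wordValue_eq (e.symm (PresentedGroup.of x))
  obtain ⟨Lτ, hLτ⟩ := exists_length_le τ
  obtain ⟨Lρ, hLρ⟩ := exists_length_le ρ
  obtain ⟨D, hD⟩ := exists_derivesWithin_substWord hS ρ e.symm.toMonoidHom (fun x => (hρ x).symm)
  obtain ⟨K, hK⟩ := exists_uniform_derivesWithin R (Lρ * Lτ + 1)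
  obtain ⟨C, hC⟩ := h
  have hτval : ∀ w, wordValue S (substWord τ w) = e (wordValue R w) :=
    wordValue_substWord τ e.toMonoidHom (fun x => (hτ x).symm)
  have hρval : ∀ w, wordValue R (substWord ρ w) = e.symm (wordValue S w) :=
    wordValue_substWord ρ e.symm.toMonoidHom (fun x => (hρ x).symm)
  have hlen : ∀ w, (substWord ρ (substWord τ w)).length ≤ Lρ * Lτ * w.length := fun w =>
    (length_substWord_le ρ hLρ _).trans <| by
      rw [mul_assoc]; exact Nat.mul_le_mul_left _ (length_substWord_le τ hLτ w)
  have hrewrite : ∀ w : GWord A, DerivesWithin R (K + (Lρ * Lτ + 1) * w.length) w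
      (substWord ρ (substWord τ w)) := by
    intro w
    induction w with
    | nil => exact .refl _ _
    | cons x w ih =>
      have h1 : DerivesWithin R K [x] (substWord ρ (substWord τ [x])) := by
        refine hK _ _ (by simp) ((hlen [x]).trans (by simp)) ?_
        rw [hρval, hτval, e.symm_apply_apply]
      have h2 := hlen [x]
      rw [List.length_singleton, mul_one] at h2
      have h3 : (Lρ * Lτ + 1) * (x :: w).length = (Lρ * Lτ + 1) * w.length + Lρ * Lτ + 1 := by
        rw [List.length_cons]; ring
      have h4 : w.length ≤ (Lρ * Lτ + 1) * w.length := Nat.le_mul_of_pos_left _ (by omega)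
      rw [show x :: w = [x] ++ w from rfl, substWord_append, substWord_append]
      rw [show x :: w = [x] ++ w from rfl] at h3
      rw [h3]
      exact (h1.append_right w (by omega)).trans (ih.append_left _ (by omega))
  refine ⟨K + Lρ * Lτ + 1 + D * (C * Lτ + C) + D, fun w hw => ?_⟩
  have h1 := hC (substWord τ w) (by rw [hτval, hw, map_one])
  have h2 := hD _ _ _ (h1.mono (Nat.add_le_add_right
    (Nat.mul_le_mul_left C (length_substWord_le τ hLτ w)) C))
  refine ((hrewrite w).mono ?_).trans (h2.mono ?_) <;>
  · ring_nf
    nlinarith [Nat.zero_le (D * C * w.length), Nat.zero_le (D * C), Nat.zero_le (K * w.length),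
      Nat.zero_le (D * C * Lτ), Nat.zero_le (D * w.length), Nat.zero_le (D * C * Lτ * w.length),
      Nat.zero_le (Lρ * Lτ), Nat.zero_le (Lρ * Lτ * w.length)]

end Substitution

/-! ### Sliding a letter through a word -/

section Sliding

variable {A B : Type*} {R : Set (GWord A)}

/-- The word over `A` obtained by replacing every letter `x` by `f x`. -/
def relabel (f : B → A) (w : GWord B) : GWord A := w.map fun x => (f x.1, x.2)

@[simp] theorem relabel_nil (f : B → A) : relabel f [] = [] := rfl

@[simp] theorem relabel_cons (f : B → A) (x : B × Bool) (w : GWord B) :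
    relabel f (x :: w) = (f x.1, x.2) :: relabel f w := rfl

@[simp] theorem relabel_append (f : B → A) (u v : GWord B) :
    relabel f (u ++ v) = relabel f u ++ relabel f v := List.map_append

@[simp] theorem length_relabel (f : B → A) (w : GWord B) :
    (relabel f w).length = w.length := List.length_map _

theorem mk_relabel (f : B → A) (w : GWord B) :
    FreeGroup.mk (relabel f w) = FreeGroup.map f (FreeGroup.mk w) := FreeGroup.map.mk.symm

/-- A letter that commutes with the letters `f x` can be moved through any word in them. -/
theorem derivesWithin_relabel_append_singleton {K : ℕ} (f : B → A) (y : A × Bool)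
    (h : ∀ x ε, DerivesWithin R K [(f x, ε), y] [y, (f x, ε)]) (w : GWord B) :
    DerivesWithin R (K + w.length) (relabel f w ++ [y]) ([y] ++ relabel f w) := by
  induction w with
  | nil => exact .refl _ _
  | cons x w ih =>
    have h1 := ih.append_left (N' := K + (x :: w).length) [(f x.1, x.2)] (by simp; omega)
    have h2 := (h x.1 x.2).append_right (N' := K + (x :: w).length) (relabel f w) (by simp)
    simpa using h1.trans (by simpa using h2)

/-- If the letters `f x` commute with `z` and act on `s` by conjugation as `z` does, then `s` can be
moved to the left through a word in the letters `f x`, at the cost of conjugating it by the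
corresponding power of `z`. The power is written without cancellation, which keeps it linear in
the length of the word. -/
theorem derivesWithin_slide {K : ℕ} (f : B → A) (z : A) (s : A × Bool)
    (hz : ∀ x ε δ, DerivesWithin R K [(f x, ε), (z, δ)] [(z, δ), (f x, ε)])
    (hs : ∀ x ε, DerivesWithin R K [(f x, ε), s] [(z, ε), s, (z, !ε), (f x, ε)])
    (w : GWord B) :
    DerivesWithin R (K + 3 * w.length + 3) (relabel f w ++ [s])
      (relabel (fun _ => z) w.reverse ++ [s] ++
        FreeGroup.invRev (relabel (fun _ => z) w.reverse) ++ relabel f w) := by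
  induction w with
  | nil => exact .refl _ _
  | cons x w ih =>
    obtain ⟨x, ε⟩ := x
    set q : GWord A := relabel (fun _ => z) w.reverse with hq
    have hqlen : q.length = w.length := by simp [hq]
    set N := K + 3 * ((x, ε) :: w).length + 3 with hN
    rw [List.length_cons] at hN
    have hqx : relabel (fun _ => z) ((x, ε) :: w).reverse = q ++ [(z, ε)] := by simp [hq]
    have hinv : FreeGroup.invRev (q ++ [(z, ε)]) = [(z, !ε)] ++ FreeGroup.invRev q := by
      simp [FreeGroup.invRev]
    have hinvlen : (FreeGroup.invRev q).length = w.length := by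
      rw [FreeGroup.invRev_length, hqlen]
    -- the letter `x` commutes with `q` and with its inverse, both being words in `z`
    have hpass : DerivesWithin R (K + w.length) ([(f x, ε)] ++ q) (q ++ [(f x, ε)]) := by
      have := derivesWithin_relabel_append_singleton (R := R) (fun _ : B => z) (f x, ε)
        (fun _ δ => (hz x ε δ).symm) w.reverse
      rw [List.length_reverse] at this
      exact this.symm
    have hpass' : DerivesWithin R (K + w.length) ([(f x, ε)] ++ FreeGroup.invRev q)
        (FreeGroup.invRev q ++ [(f x, ε)]) := by
      have := derivesWithin_relabel_append_singleton (R := R) (fun _ : B => z) (f x, ε)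
        (fun _ δ => (hz x ε δ).symm) (FreeGroup.invRev w.reverse)
      rw [FreeGroup.invRev_length, List.length_reverse] at this
      have h : relabel (fun _ => z) (FreeGroup.invRev w.reverse) = FreeGroup.invRev q := by
        simp [hq, relabel, FreeGroup.invRev, Function.comp_def]
      rw [h] at this
      exact this.symm
    have h1 := ih.append_left (N' := N) [(f x, ε)] (by rw [List.length_singleton]; omega)
    have h2 := hpass.append_right (N' := N) ([s] ++ FreeGroup.invRev q ++ relabel f w)
      (by simp only [List.length_append, List.length_singleton, length_relabel]; omega)
    have h3 := (hs x ε).context (N' := N) q (FreeGroup.invRev q ++ relabel f w)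
      (by simp only [List.length_append, length_relabel]; omega)
    have h4 := hpass'.context (N' := N) (q ++ [(z, ε), s, (z, !ε)]) (relabel f w)
      (by simp only [List.length_append, List.length_cons, List.length_nil, length_relabel]; omega)
    rw [hqx, hinv]
    simp only [relabel_cons, List.append_assoc, List.cons_append, List.nil_append] at h1 h2 h3 h4 ⊢
    exact h1.trans (h2.trans (h3.trans h4))

theorem wordValue_singleton (x : A) (ε : Bool) :
    wordValue R [(x, ε)] = bif ε then PresentedGroup.of x else (PresentedGroup.of x)⁻¹ := by
  cases ε
  · rw [show [(x, false)] = FreeGroup.invRev [(x, true)] from rfl, wordValue_invRev]; rfl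
  · rfl

theorem wordValue_cons (x : A × Bool) (w : GWord A) :
    wordValue R (x :: w) = wordValue R [x] * wordValue R w := wordValue_append [x] w

theorem wordValue_swap {x z : A}
    (h : Commute (PresentedGroup.of x : WordPresentedGroup R) (PresentedGroup.of z))
    (ε δ : Bool) : wordValue R [(x, ε), (z, δ)] = wordValue R [(z, δ), (x, ε)] := by
  rw [wordValue_cons, wordValue_cons (z, δ)]
  simp only [wordValue_singleton]
  cases ε <;> cases δ <;> simp only [cond_true, cond_false]
  exacts [h.inv_inv, h.inv_left, h.inv_right, h]

theorem wordValue_conj {x z s : A}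
    (h : Commute (PresentedGroup.of x : WordPresentedGroup R) (PresentedGroup.of z))
    (hs : Commute (PresentedGroup.of s : WordPresentedGroup R)
      (PresentedGroup.of x * (PresentedGroup.of z)⁻¹)) (ε δ : Bool) :
    wordValue R [(x, ε), (s, δ)] = wordValue R [(z, ε), (s, δ), (z, !ε), (x, ε)] := by
  set X : WordPresentedGroup R := PresentedGroup.of x
  set Z : WordPresentedGroup R := PresentedGroup.of z
  set S : WordPresentedGroup R := wordValue R [(s, δ)] with hS
  have hs' : S * (X * Z⁻¹) = X * Z⁻¹ * S := by
    rw [hS, wordValue_singleton]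
    cases δ
    exacts [hs.inv_left, hs]
  have hxz : X * Z⁻¹ = Z⁻¹ * X := h.inv_right
  rw [wordValue_cons, wordValue_cons (z, ε), wordValue_cons (s, δ) [_, _],
    wordValue_cons (z, !ε), ← hS]
  simp only [wordValue_singleton]
  cases ε <;> simp only [cond_true, cond_false, Bool.not_true, Bool.not_false]
  · change X⁻¹ * S = Z⁻¹ * (S * (Z * X⁻¹))
    have h1 : Z * X⁻¹ = (X * Z⁻¹)⁻¹ := by group
    have h2 : S * (X * Z⁻¹)⁻¹ = (X * Z⁻¹)⁻¹ * S := by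
      rw [mul_inv_eq_iff_eq_mul, mul_assoc, hs', inv_mul_cancel_left]
    rw [h1, h2]; group
  · change X * S = Z * (S * (Z⁻¹ * X))
    rw [← hxz, hs', hxz]; group

end Sliding

/-! ### Linear derivations in Stallings' group -/

section Stallings

open StallingsGen

/-- The letters `a`, `s`: they generate a free group that projects isomorphically to the third
factor of `F₂ × F₂ × F₂`. -/
def lettersAS : Fin 2 → StallingsGen := ![a, s]

/-- The letters `a`, `b`. -/
def lettersAB : Fin 2 → StallingsGen := ![a, b]

/-- The letters `c`, `d`. -/
def lettersCD : Fin 2 → StallingsGen := ![c, d]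

instance : Finite StallingsGen :=
  Finite.of_surjective (fun i : Fin 5 => ![a, b, c, d, s] i) fun x => by
    cases x
    exacts [⟨0, rfl⟩, ⟨1, rfl⟩, ⟨2, rfl⟩, ⟨3, rfl⟩, ⟨4, rfl⟩]

theorem finite_stallingsRelators : stallingsRelators.Finite := by
  unfold stallingsRelators
  exact Set.toFinite _

theorem commute_of_commWord_mem {A : Type*} {R : Set (GWord A)} {x y : A}
    (h : commWord x y ∈ R) :
    Commute (PresentedGroup.of x : WordPresentedGroup R) (PresentedGroup.of y) := by
  have h1 := wordValue_eq_one_of_mem h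
  rw [commWord, wordValue_cons, wordValue_cons (y, false), wordValue_cons (x, true)] at h1
  simp only [wordValue_singleton, cond_true, cond_false] at h1
  rw [← mul_assoc, ← mul_inv_rev, inv_mul_eq_one] at h1
  exact h1.symm

theorem commute_of_conjWord_mem {A : Type*} {R : Set (GWord A)} {s x y : A}
    (h : conjWord s x y ∈ R) :
    Commute (PresentedGroup.of s : WordPresentedGroup R)
      (PresentedGroup.of x * (PresentedGroup.of y)⁻¹) := by
  have h1 := wordValue_eq_one_of_mem h
  rw [conjWord, wordValue_cons, wordValue_cons (s, true), wordValue_cons (x, true),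
    wordValue_cons (y, false), wordValue_cons (s, false)] at h1
  simp only [wordValue_singleton, cond_true, cond_false] at h1
  set X : WordPresentedGroup R := PresentedGroup.of x
  set Y : WordPresentedGroup R := PresentedGroup.of y
  set S : WordPresentedGroup R := PresentedGroup.of s
  calc S * (X * Y⁻¹) = X * (X⁻¹ * (S * (X * (Y⁻¹ * (S⁻¹ * Y))))) * Y⁻¹ * S := by group
    _ = X * Y⁻¹ * S := by rw [h1, mul_one]

theorem commute_lettersAB_lettersCD (i j : Fin 2) :
    Commute (PresentedGroup.of (lettersAB i) : WordPresentedGroup stallingsRelators)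
      (PresentedGroup.of (lettersCD j)) := by
  refine commute_of_commWord_mem ?_
  fin_cases i <;> fin_cases j <;> simp [stallingsRelators, lettersAB, lettersCD]

theorem commute_s_lettersAB (i : Fin 2) :
    Commute (PresentedGroup.of s : WordPresentedGroup stallingsRelators)
      (PresentedGroup.of (lettersAB i) * (PresentedGroup.of c)⁻¹) := by
  refine commute_of_conjWord_mem ?_
  fin_cases i <;> simp [stallingsRelators, lettersAB]

theorem commute_s_lettersCD (i : Fin 2) :
    Commute (PresentedGroup.of s : WordPresentedGroup stallingsRelators)
      (PresentedGroup.of (lettersCD i) * (PresentedGroup.of a)⁻¹) := by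
  have h : Commute (PresentedGroup.of s : WordPresentedGroup stallingsRelators)
      (PresentedGroup.of a * (PresentedGroup.of (lettersCD i))⁻¹) := by
    refine commute_of_conjWord_mem ?_
    fin_cases i <;> simp [stallingsRelators, lettersCD]
  simpa using h.inv_right

theorem exponentSum_mk_reverse (w : GWord (Fin 2)) :
    exponentSum (FreeGroup.mk w.reverse) = exponentSum (FreeGroup.mk w) := by
  rw [exponentSum, FreeGroup.lift_mk, FreeGroup.lift_mk, List.map_reverse]
  exact (List.reverse_perm _).prod_eq

theorem exponentSum_of (i : Fin 2) :
    exponentSum (FreeGroup.of i) = Multiplicative.ofAdd (1 : ℤ) := FreeGroup.lift_apply_of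

theorem exponentSum_map (f : Fin 2 → Fin 2) (g : FreeGroup (Fin 2)) :
    exponentSum (FreeGroup.map f g) = exponentSum g := by
  have : exponentSum.comp (FreeGroup.map f) = exponentSum := by
    ext i
    simp [exponentSum_of]
  exact DFunLike.congr_fun this g

theorem map_const_eq {A : Type*} (z : A) (g : FreeGroup (Fin 2)) :
    FreeGroup.map (fun _ => z) g = zpowersHom _ (FreeGroup.of z) (exponentSum g) := by
  have : FreeGroup.map (fun _ : Fin 2 => z) =
      (zpowersHom _ (FreeGroup.of z)).comp exponentSum := by
    ext i
    simp [exponentSum_of]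
  exact DFunLike.congr_fun this g

/-- The letter `s` commutes with the kernel of `F(a, b) × F(c, d) → ℤ`, through words of linearly
bounded length: it is moved first through the word in `c`, `d`, which conjugates it by a power of
`a`, and then through all letters `a`, `b` in front of it, which conjugates it by a power of `c` of
exponent zero. -/
theorem exists_derivesWithin_s :
    ∃ K, ∀ (v t : GWord (Fin 2)) (η : Bool),
      exponentSum (FreeGroup.mk v) * exponentSum (FreeGroup.mk t) = 1 →
      DerivesWithin stallingsRelators (K + 6 * (v.length + t.length))
        (relabel lettersAB v ++ relabel lettersCD t ++ [(s, η)])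
        ([(s, η)] ++ relabel lettersAB v ++ relabel lettersCD t) := by
  obtain ⟨K, hK⟩ := exists_uniform_derivesWithin stallingsRelators 4
  refine ⟨K + 3, fun v t η hexp => ?_⟩
  -- `v'` is the power of `a` left behind by `t`, `q` the power of `c` left behind by `v v'`
  set v' : GWord (Fin 2) := relabel (fun _ => 0) t.reverse with hv'
  have hv'len : v'.length = t.length := by simp [hv']
  have hv'rel : relabel lettersAB v' = relabel (fun _ => a) t.reverse := by
    simp [hv', relabel, lettersAB]
  set q : GWord StallingsGen := relabel (fun _ => c) (v ++ v').reverse with hq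
  have hqlen : q.length = v.length + t.length := by
    rw [hq, length_relabel, List.length_reverse, List.length_append, hv'len]
  have hexp' : exponentSum (FreeGroup.mk v') = exponentSum (FreeGroup.mk t) := by
    rw [hv', mk_relabel, exponentSum_map, exponentSum_mk_reverse]
  have hq1 : FreeGroup.mk q = 1 := by
    rw [hq, mk_relabel, map_const_eq, exponentSum_mk_reverse, ← FreeGroup.mul_mk, map_mul, hexp',
      hexp, map_one]
  have h1 := derivesWithin_slide lettersCD a (s, η) (R := stallingsRelators) (K := K)
    (fun x ε δ => hK _ _ (by simp) (by simp)
      (wordValue_swap (commute_lettersAB_lettersCD 0 x).symm ε δ))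
    (fun x ε => hK _ _ (by simp) (by simp)
      (wordValue_conj (commute_lettersAB_lettersCD 0 x).symm (commute_s_lettersCD x) ε η)) t
  have h2 := derivesWithin_slide lettersAB c (s, η) (R := stallingsRelators) (K := K)
    (fun x ε δ => hK _ _ (by simp) (by simp)
      (wordValue_swap (commute_lettersAB_lettersCD x 0) ε δ))
    (fun x ε => hK _ _ (by simp) (by simp)
      (wordValue_conj (commute_lettersAB_lettersCD x 0) (commute_s_lettersAB x) ε η)) (v ++ v')
  rw [← hv'rel] at h1
  rw [← hq] at h2
  rw [List.length_append, hv'len] at h2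
  have h1' := h1.append_left (N' := K + 3 + 6 * (v.length + t.length)) (relabel lettersAB v)
    (by rw [length_relabel]; omega)
  have h2' := h2.append_right (N' := K + 3 + 6 * (v.length + t.length))
    (FreeGroup.invRev (relabel lettersAB v') ++ relabel lettersCD t)
    (by simp only [List.length_append, FreeGroup.invRev_length, length_relabel, hv'len]; omega)
  simp only [List.append_assoc, relabel_append] at h1' h2' ⊢
  refine h1'.trans (h2'.trans (.of_mk_eq ?_ ?_ ?_))
  · simp only [← FreeGroup.mul_mk, ← FreeGroup.inv_mk, hq1]
    group
  · simp only [List.length_append, FreeGroup.invRev_length, length_relabel,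
      List.length_singleton, hqlen, hv'len]
    omega
  · simp only [List.length_append, length_relabel, List.length_singleton]
    omega

/-- Every word can be rewritten, through words of linearly bounded length, as a word in `a`, `s`
followed by a word in `a`, `b` and a word in `c`, `d` of total exponent sum zero. -/
theorem exists_derivesWithin_normalForm :
    ∃ K, ∀ w : GWord StallingsGen, ∃ u v t : GWord (Fin 2),
      u.length ≤ w.length ∧ v.length + t.length ≤ 2 * w.length ∧
      exponentSum (FreeGroup.mk v) * exponentSum (FreeGroup.mk t) = 1 ∧
      DerivesWithin stallingsRelators (K + 13 * w.length) w
        (relabel lettersAS u ++ relabel lettersAB v ++ relabel lettersCD t) := by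
  obtain ⟨K₁, hK₁⟩ := exists_uniform_derivesWithin stallingsRelators 2
  obtain ⟨K₂, hK₂⟩ := exists_derivesWithin_s
  refine ⟨K₁ + K₂, fun w => ?_⟩
  induction w using List.reverseRecOn with
  | nil => exact ⟨[], [], [], by simp, by simp, by simp [← FreeGroup.one_eq_mk], .refl _ _⟩
  | append_singleton w y ih =>
    obtain ⟨u, v, t, hu, hvt, hexp, h⟩ := ih
    obtain ⟨y, ε⟩ := y
    have h' := h.append_right (N' := K₁ + K₂ + 13 * (w ++ [(y, ε)]).length) [(y, ε)]
      (by simp [mul_add])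
    -- a pair `a^ε a^{-ε}` is inserted between `u` and `v`, which keeps the exponent sum of the
    -- last two parts zero once the new letter has been added to one of them
    have hsplit : ∀ i, FreeGroup.mk (relabel lettersAS (u ++ [(0, ε)])) *
        FreeGroup.mk (relabel lettersAB ((0, !ε) :: v ++ i)) =
        FreeGroup.mk (relabel lettersAS u) * FreeGroup.mk (relabel lettersAB v) *
        FreeGroup.mk (relabel lettersAB i) := by
      intro i
      have h0 : FreeGroup.mk [(a, !ε)] = (FreeGroup.mk [(a, ε)])⁻¹ := by
        rw [FreeGroup.inv_mk]; rfl
      have h1 : FreeGroup.mk (relabel lettersAS (u ++ [(0, ε)])) =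
          FreeGroup.mk (relabel lettersAS u) * FreeGroup.mk [(a, ε)] := by
        rw [relabel_append, FreeGroup.mul_mk]; rfl
      have h2 : FreeGroup.mk (relabel lettersAB ((0, !ε) :: v ++ i)) =
          FreeGroup.mk [(a, !ε)] * FreeGroup.mk (relabel lettersAB v) *
            FreeGroup.mk (relabel lettersAB i) := by
        rw [relabel_append, FreeGroup.mul_mk, FreeGroup.mul_mk]; rfl
      rw [h1, h2, h0]
      group
    have hsgn : exponentSum (FreeGroup.mk [(0, !ε)]) = (exponentSum (FreeGroup.mk [(0, ε)]))⁻¹ := by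
      rw [← map_inv, FreeGroup.inv_mk]; rfl
    have hexpi : ∀ i : Fin 2, exponentSum (FreeGroup.mk [(i, ε)]) =
        exponentSum (FreeGroup.mk [(0, ε)]) := by
      intro i; simp [exponentSum, FreeGroup.lift_mk]
    -- a letter `a` or `b`
    have hAB : ∀ i, lettersAB i = y → ∃ u v t : GWord (Fin 2),
        u.length ≤ (w ++ [(y, ε)]).length ∧ v.length + t.length ≤ 2 * (w ++ [(y, ε)]).length ∧
        exponentSum (FreeGroup.mk v) * exponentSum (FreeGroup.mk t) = 1 ∧
        DerivesWithin stallingsRelators (K₁ + K₂ + 13 * (w ++ [(y, ε)]).length) (w ++ [(y, ε)])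
          (relabel lettersAS u ++ relabel lettersAB v ++ relabel lettersCD t) := by
      rintro i rfl
      refine ⟨u ++ [(0, ε)], (0, !ε) :: v ++ [(i, ε)], t, by simp; omega, by simp; omega, ?_, ?_⟩
      · rw [← hexp, ← FreeGroup.mul_mk, show (0, !ε) :: v = [(0, !ε)] ++ v from rfl,
          ← FreeGroup.mul_mk, map_mul, map_mul, hsgn, hexpi i, inv_mul_cancel_comm]
      · refine h'.trans (DerivesWithin.trans (v := relabel lettersAS u ++ relabel lettersAB v ++
          [(lettersAB i, ε)] ++ relabel lettersCD t) ?_ (.of_mk_eq ?_ ?_ ?_))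
        · have := (derivesWithin_relabel_append_singleton (R := stallingsRelators) (K := K₁)
            lettersCD (lettersAB i, ε) (fun x δ => hK₁ _ _ (by simp) (by simp)
              (wordValue_swap (commute_lettersAB_lettersCD i x).symm δ ε)) t).append_left
            (N' := K₁ + K₂ + 13 * (w ++ [(lettersAB i, ε)]).length)
            (relabel lettersAS u ++ relabel lettersAB v) (by simp; omega)
          simpa only [List.append_assoc] using this
        · rw [← FreeGroup.mul_mk (L₂ := relabel lettersCD t),
            ← FreeGroup.mul_mk (L₂ := relabel lettersCD t),
            ← FreeGroup.mul_mk (L₁ := relabel lettersAS (u ++ [(0, ε)])), hsplit,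
            FreeGroup.mul_mk, FreeGroup.mul_mk]
          rfl
        · simp; omega
        · simp; omega
    -- a letter `c` or `d`
    have hCD : ∀ i, lettersCD i = y → ∃ u v t : GWord (Fin 2),
        u.length ≤ (w ++ [(y, ε)]).length ∧ v.length + t.length ≤ 2 * (w ++ [(y, ε)]).length ∧
        exponentSum (FreeGroup.mk v) * exponentSum (FreeGroup.mk t) = 1 ∧
        DerivesWithin stallingsRelators (K₁ + K₂ + 13 * (w ++ [(y, ε)]).length) (w ++ [(y, ε)])
          (relabel lettersAS u ++ relabel lettersAB v ++ relabel lettersCD t) := by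
      rintro i rfl
      refine ⟨u ++ [(0, ε)], (0, !ε) :: v, t ++ [(i, ε)], by simp; omega, by simp; omega, ?_, ?_⟩
      · rw [← hexp, ← FreeGroup.mul_mk, show (0, !ε) :: v = [(0, !ε)] ++ v from rfl,
          ← FreeGroup.mul_mk, map_mul, map_mul, hsgn, hexpi i, mul_comm (exponentSum _)⁻¹,
          mul_assoc, mul_comm (exponentSum (FreeGroup.mk t)), inv_mul_cancel_left]
      · refine h'.trans (.of_mk_eq ?_ ?_ ?_)
        · have := hsplit []
          rw [List.append_nil, relabel_nil, ← FreeGroup.one_eq_mk, mul_one] at this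
          rw [← FreeGroup.mul_mk (L₂ := relabel lettersCD (t ++ [(i, ε)])),
            ← FreeGroup.mul_mk (L₁ := relabel lettersAS (u ++ [(0, ε)])), this,
            FreeGroup.mul_mk, FreeGroup.mul_mk, relabel_append, ← List.append_assoc]
          rfl
        · simp; omega
        · simp; omega
    cases y with
    | a => exact hAB 0 rfl
    | b => exact hAB 1 rfl
    | c => exact hCD 0 rfl
    | d => exact hCD 1 rfl
    | s =>
      refine ⟨u ++ [(1, ε)], v, t, by simp; omega, by simp; omega, hexp, h'.trans ?_⟩
      have := (hK₂ v t ε hexp).append_left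
        (N' := K₁ + K₂ + 13 * (w ++ [(s, ε)]).length) (relabel lettersAS u) (by simp; omega)
      simpa [lettersAS] using this

/-! ### The isomorphism with the kernel -/

/-- The elements of `F₂ × F₂ × F₂` represented by the generators. -/
def stallingsGenImage :
    StallingsGen → FreeGroup (Fin 2) × FreeGroup (Fin 2) × FreeGroup (Fin 2)
  | a => (.of 0, 1, (.of 0)⁻¹)
  | b => (.of 1, 1, (.of 0)⁻¹)
  | c => (1, .of 0, (.of 0)⁻¹)
  | d => (1, .of 1, (.of 0)⁻¹)
  | s => (1, 1, .of 1 * (.of 0)⁻¹)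

theorem lift_stallingsGenImage_relator {r : GWord StallingsGen} (hr : r ∈ stallingsRelators) :
    FreeGroup.lift stallingsGenImage (FreeGroup.mk r) = 1 := by
  simp only [stallingsRelators, Set.mem_insert_iff, Set.mem_singleton_iff] at hr
  rcases hr with rfl | rfl | rfl | rfl | rfl | rfl | rfl | rfl | rfl | rfl <;>
    simp [commWord, conjWord, FreeGroup.lift_mk, stallingsGenImage, Prod.ext_iff]
  all_goals group

/-- The homomorphism from the presented group to `F₂ × F₂ × F₂`. -/
def stallingsToProd : WordPresentedGroup stallingsRelators →*
    FreeGroup (Fin 2) × FreeGroup (Fin 2) × FreeGroup (Fin 2) :=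
  PresentedGroup.toGroup (f := stallingsGenImage) <| by
    rintro _ ⟨r, hr, rfl⟩
    exact lift_stallingsGenImage_relator hr

theorem stallingsToProd_wordValue (w : GWord StallingsGen) :
    stallingsToProd (wordValue stallingsRelators w) =
      FreeGroup.lift stallingsGenImage (FreeGroup.mk w) := rfl

/-- The third coordinates of `a` and `s` form a basis of `F₂`. -/
theorem lift_lettersAS_injective {u : FreeGroup (Fin 2)}
    (h : (FreeGroup.lift stallingsGenImage (FreeGroup.map lettersAS u)).2.2 = 1) : u = 1 := by
  have key : (FreeGroup.lift ![(FreeGroup.of 0)⁻¹, FreeGroup.of 1 * (FreeGroup.of 0)⁻¹]).comp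
      ((MonoidHom.snd _ _).comp ((MonoidHom.snd _ _).comp
        ((FreeGroup.lift stallingsGenImage).comp (FreeGroup.map lettersAS)))) =
      MonoidHom.id (FreeGroup (Fin 2)) := by
    ext i
    fin_cases i <;> simp [lettersAS, stallingsGenImage]
  have h1 := DFunLike.congr_fun key u
  simp only [MonoidHom.comp_apply, MonoidHom.coe_snd, h, map_one, MonoidHom.id_apply] at h1
  exact h1.symm

theorem lift_lettersAB (g : FreeGroup (Fin 2)) :
    FreeGroup.lift stallingsGenImage (FreeGroup.map lettersAB g) =
      (g, 1, zpowersHom _ (FreeGroup.of 0)⁻¹ (exponentSum g)) := by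
  have key : (FreeGroup.lift stallingsGenImage).comp (FreeGroup.map lettersAB) =
      (MonoidHom.id _).prod ((1 : FreeGroup (Fin 2) →* FreeGroup (Fin 2)).prod
        ((zpowersHom _ (FreeGroup.of 0)⁻¹).comp exponentSum)) := by
    ext i : 1
    fin_cases i <;> simp [lettersAB, stallingsGenImage, exponentSum_of]
  exact DFunLike.congr_fun key g

theorem lift_lettersCD (g : FreeGroup (Fin 2)) :
    FreeGroup.lift stallingsGenImage (FreeGroup.map lettersCD g) =
      (1, g, zpowersHom _ (FreeGroup.of 0)⁻¹ (exponentSum g)) := by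
  have key : (FreeGroup.lift stallingsGenImage).comp (FreeGroup.map lettersCD) =
      (1 : FreeGroup (Fin 2) →* FreeGroup (Fin 2)).prod ((MonoidHom.id _).prod
        ((zpowersHom _ (FreeGroup.of 0)⁻¹).comp exponentSum)) := by
    ext i : 1
    fin_cases i <;> simp [lettersCD, stallingsGenImage, exponentSum_of]
  exact DFunLike.congr_fun key g

/-- A word that is trivial in `F₂ × F₂ × F₂` has a normal form whose three parts are freely
trivial, so that free reductions finish its derivation. -/
theorem exists_derivesWithin_of_stallingsToProd_eq_one :
    ∃ C, ∀ w : GWord StallingsGen, stallingsToProd (wordValue stallingsRelators w) = 1 →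
      DerivesWithin stallingsRelators (C * w.length + C) w [] := by
  obtain ⟨K, hK⟩ := exists_derivesWithin_normalForm
  refine ⟨K + 13, fun w hw => ?_⟩
  obtain ⟨u, v, t, hu, hvt, hexp, h⟩ := hK w
  rw [h.wordValue_eq, stallingsToProd_wordValue] at hw
  simp only [← FreeGroup.mul_mk, mk_relabel, map_mul, lift_lettersAB, lift_lettersCD] at hw
  have hu1 : FreeGroup.mk u = 1 := by
    refine lift_lettersAS_injective ?_
    have h3 := congrArg (fun g => g.2.2) hw
    simpa only [Prod.snd_mul, Prod.snd_one, mul_assoc, ← map_mul, hexp, map_one, mul_one] using h3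
  rw [hu1, map_one, map_one, one_mul, Prod.mk_mul_mk, Prod.mk_mul_mk, mul_one, one_mul] at hw
  have hv1 : FreeGroup.mk v = 1 := congrArg Prod.fst hw
  have ht1 : FreeGroup.mk t = 1 := congrArg (fun g => g.2.1) hw
  have hbound : K + 13 * w.length ≤ (K + 13) * w.length + (K + 13) := by nlinarith
  refine (h.mono hbound).trans (.of_mk_eq ?_ ?_ (Nat.zero_le _))
  · simp only [← FreeGroup.mul_mk, mk_relabel, hu1, hv1, ht1, map_one, mul_one]; rfl
  · simp only [List.length_append, length_relabel]
    omega

theorem stallingsToProd_injective : Function.Injective stallingsToProd := by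
  refine (injective_iff_map_eq_one _).2 fun g hg => ?_
  obtain ⟨w, rfl⟩ := exists_wordValue_eq g
  obtain ⟨C, hC⟩ := exists_derivesWithin_of_stallingsToProd_eq_one
  exact (hC w hg).wordValue_eq

theorem hasLinearDerivations_stallingsRelators : HasLinearDerivations stallingsRelators := by
  obtain ⟨C, hC⟩ := exists_derivesWithin_of_stallingsToProd_eq_one
  exact ⟨C, fun w hw => hC w (by rw [hw, map_one])⟩

theorem range_stallingsToProd : stallingsToProd.range = stallingsHom.ker := by
  apply le_antisymm
  · rintro _ ⟨g, rfl⟩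
    have key : stallingsHom.comp stallingsToProd = 1 := by
      ext x
      cases x <;> simp [stallingsToProd, stallingsGenImage, stallingsHom, exponentSum_of]
    exact DFunLike.congr_fun key g
  · rintro ⟨g₁, g₂, g₃⟩ hg
    have hsum : exponentSum g₁ * (exponentSum g₂ * exponentSum g₃) = 1 := hg
    have hrange : ∀ g, FreeGroup.lift stallingsGenImage g ∈ stallingsToProd.range :=
      fun g => ⟨PresentedGroup.mk _ g, rfl⟩
    -- a lift of the third factor, inverse to the projection of `⟨a, s⟩`
    set σ : FreeGroup (Fin 2) →* FreeGroup StallingsGen :=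
      FreeGroup.lift ![(FreeGroup.of a)⁻¹, FreeGroup.of s * (FreeGroup.of a)⁻¹] with hσ
    have hσ' : (FreeGroup.lift stallingsGenImage).comp σ =
        ((zpowersHom _ (FreeGroup.of 0)⁻¹).comp exponentSum).prod
          ((1 : FreeGroup (Fin 2) →* FreeGroup (Fin 2)).prod (MonoidHom.id _)) := by
      ext i : 1
      fin_cases i <;> simp [hσ, stallingsGenImage, exponentSum_of]
    have hσ3 : FreeGroup.lift stallingsGenImage (σ g₃) =
        (zpowersHom _ (FreeGroup.of 0)⁻¹ (exponentSum g₃), 1, g₃) := DFunLike.congr_fun hσ' g₃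
    set p := zpowersHom _ (FreeGroup.of (0 : Fin 2))⁻¹ (exponentSum g₃) with hp
    have hexp : exponentSum p = (exponentSum g₃)⁻¹ := by
      simp [hp, exponentSum_of, ← ofAdd_zsmul]
    have := mul_mem (mul_mem (hrange (σ g₃)) (hrange (FreeGroup.map lettersAB (p⁻¹ * g₁))))
      (hrange (FreeGroup.map lettersCD g₂))
    have hcancel : exponentSum (p⁻¹ * g₁) * exponentSum g₂ = 1 := by
      rw [map_mul, map_inv, hexp, inv_inv, mul_assoc, mul_comm, mul_assoc, hsum]
    simp only [hσ3, lift_lettersAB, lift_lettersCD, Prod.mk_mul_mk, mul_one, one_mul,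
      mul_inv_cancel_left] at this
    rw [mul_assoc, ← map_mul, hcancel, map_one, mul_one] at this
    exact this

theorem nonempty_mulEquiv_stallingsGroup :
    Nonempty (WordPresentedGroup stallingsRelators ≃* StallingsGroup) :=
  ⟨(MonoidHom.ofInjective stallingsToProd_injective).trans
    (MulEquiv.subgroupCongr range_stallingsToProd)⟩

end Stallings

theorem mainTheorem4 :
    Nonempty (WordPresentedGroup stallingsRelators ≃* StallingsGroup) ∧
    ∀ {A : Type*} [Finite A] (R : Set (GWord A)), R.Finite →
      Nonempty (WordPresentedGroup R ≃* StallingsGroup) →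
        (∃ C : ℕ, IsIsodiametricFunction R (fun n => C * n)) ∧
        ∃ FL : ℕ → ℕ, (∀ n, (FL n : ℕ∞) = fillingLengthFunction R n) ∧
          FillingEquiv FL (fun n => n) := by
  refine ⟨nonempty_mulEquiv_stallingsGroup, fun {A} _ R _ ⟨e⟩ => ?_⟩
  obtain ⟨e₀⟩ := nonempty_mulEquiv_stallingsGroup
  have h : HasLinearDerivations R :=
    hasLinearDerivations_stallingsRelators.of_mulEquiv finite_stallingsRelators (e.trans e₀.symm)
  exact ⟨h.isIsodiametricFunction, h.fillingLengthFunction_equiv⟩
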